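/- Let $k\in\mathbb N$ and let $\Lambda$ be a $k$-graph, i.e. a countable small category with a degree functor $d:\Lambda\to\mathbb N^k$ such that every $\lambda$ with $d(\lambda)=m+n$ factors uniquely as $\lambda=\mu\nu$ with $d(\mu)=m$, $d(\nu)=n$. Write $r,s$ for range and source and $\Lambda^n=d^{-1}(n)$. Assume that $\Lambda$ is row-finite and has no sources: $\{\lambda\in\Lambda^n : r(\lambda)=v\}$ is finite and non-empty for all $v\in\Lambda^0$, $n\in\mathbb N^k$. Let $\Lambda^\infty$ be the space of infinite paths, with shifts $\sigma^m$ and with the topology generated by the cylinder sets $Z(\lambda)=\{x : x(0,d(\lambda))=\lambda\}$. Let $\{t_\lambda\}_{\lambda\in\Lambda}$ be a representation of $C^*(\Lambda)$ (a Cuntz–Krieger $\Lambda$-family) on a complex Hilbert space $\mathcal H$, and let $P$ be its projection valued measure, the one on the Borel sets of $\Lambda^\infty$ with $P(Z(\lambda))=t_\lambda t_\lambda^*$. The representation is *purely atomic* if there is a Borel set $\Omega\subset\Lambda^\infty$ with $P(\Lambda^\infty\setminus\Omega)=0$, $P(\{x\})\neq0$ for all $x\in\Omega$, and $\bigoplus_{x\in\Omega}P(\{x\})=\mathrm{Id}_{\mathcal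 H}$ in the strong operator topology. It is *permutative* if $\mathcal H$ has an orthonormal basis $\{e_i\}_{i\in I}$ and for each $\lambda\in\Lambda$ there are $J_\lambda,K_\lambda\subset I$ and a bijection $\tilde\sigma_\lambda:J_\lambda\to K_\lambda$ such that (a) $\bigcup_{\lambda\in\Lambda^n}K_\lambda=I$ for each $n\in\mathbb N^k$; (b) if $s(\lambda)=r(\nu)$, then $K_\nu\subset J_\lambda$ and $\tilde\sigma_\lambda\circ\tilde\sigma_\nu=\tilde\sigma_{\lambda\nu}$ (in particular $J_{\lambda\nu}=J_\nu$); (c) $t_\lambda e_i=e_{\tilde\sigma_\lambda(i)}$ for $i\in J_\lambda$, and $t_\lambda e_i=0$ for $i\notin J_\lambda$; (d) $t_\lambda^*e_{\tilde\sigma_\lambda(i)}=e_i$ for $i\in J_\lambda$, and $t_\lambda^*e_j=0$ for $j\in K_{\lambda'}$ whenever $\lambda'\ne\lambda$ and $d(\lambda')=d(\lambda)$. Its *encoding map* $E:I\to\Lambda^\infty$ is given by: $E(i)(0,n)$ is the unique $\lambda\in\Lambda^n$ with $i\in K_\lambda$. **Theorem.** Suppose that the representation is purely atomic and that $P$ is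 supported on $\mathrm{Orbit}(\omega)=\{x\in\Lambda^\infty : \sigma^m(x)=\sigma^l(\omega)\text{ for some } m,l\in\mathbb N^k\}$, i.e. $P(\Lambda^\infty\setminus\mathrm{Orbit}(\omega))=0$, where $\omega\in\Lambda^\infty$ is aperiodic: $\sigma^m(\omega)\neq\sigma^n(\omega)$ whenever $m\neq n$. Then 1. the representation is permutative; 2. the representation is a direct sum of permutative representations, on mutually orthogonal closed reducing subspaces whose Hilbert space sum is $\mathcal H$, each having an injective encoding map. Moreover, in 1 and in each summand in 2 the permutative structure can be chosen so that in addition $\bigcup_{\lambda\in\Lambda^n}J_\lambda=I$ for every $n\in\mathbb N^k$ such that for each $x\in\mathrm{Orbit}(\omega)$ the vertex $r(x)$ is the source of some path in $\Lambda^n$. -/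

import Mathlib

open scoped InnerProductSpace

universe u v

/-- A `k`-graph: a countable small category (given by its objects `Vert`, its morphisms `Mor`,
range, source, identities and composition) with a degree functor to `ℕ^k` that has the unique
factorization property.  The composite `comp a b` is the morphism `ab`; it is meaningful only
when `s a = r b`, and every law below is restricted to that case. -/
structure KGraph (k : ℕ) where
  Vert : Type u
  Mor : Type u
  countable_mor : Countable Mor
  r : Mor → Vert
  s : Mor → Vert
  one : Vert → Mor
  comp : Mor → Mor → Mor
  r_one : ∀ x, r (one x) = x
  s_one : ∀ x, s (one x) = x
  r_comp : ∀ a b, s a = r b → r (comp a b) = r a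
  s_comp : ∀ a b, s a = r b → s (comp a b) = s b
  one_comp : ∀ a, comp (one (r a)) a = a
  comp_one : ∀ a, comp a (one (s a)) = a
  comp_assoc : ∀ a b c, s a = r b → s b = r c → comp (comp a b) c = comp a (comp b c)
  d : Mor → (Fin k → ℕ)
  d_one : ∀ x, d (one x) = 0
  d_comp : ∀ a b, s a = r b → d (comp a b) = d a + d b
  factorization : ∀ (a : Mor) (m n : Fin k → ℕ), d a = m + n →
    ∃! p : Mor × Mor, s p.1 = r p.2 ∧ comp p.1 p.2 = a ∧ d p.1 = m ∧ d p.2 = n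

namespace KGraph

variable {k : ℕ}

/-- The set `xΛⁿ` of paths of degree `n` with range `x`. -/
def pathsTo (Λ : KGraph.{u} k) (x : Λ.Vert) (n : Fin k → ℕ) : Set Λ.Mor :=
  {a | Λ.r a = x ∧ Λ.d a = n}

def RowFinite (Λ : KGraph.{u} k) : Prop :=
  ∀ (x : Λ.Vert) (n : Fin k → ℕ), (Λ.pathsTo x n).Finite

def NoSources (Λ : KGraph.{u} k) : Prop :=
  ∀ (x : Λ.Vert) (n : Fin k → ℕ), (Λ.pathsTo x n).Nonempty

end KGraph

/-- An infinite path: a degree preserving functor to `Λ` from the category with objects `ℕ^k`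
and one morphism `(p, q)`, of range `p` and source `q`, for each pair `p ≤ q`. -/
@[ext]
structure InfinitePath {k : ℕ} (Λ : KGraph.{u} k) where
  vert : (Fin k → ℕ) → Λ.Vert
  seg : ∀ p q : Fin k → ℕ, p ≤ q → Λ.Mor
  r_seg : ∀ p q h, Λ.r (seg p q h) = vert p
  s_seg : ∀ p q h, Λ.s (seg p q h) = vert q
  d_seg : ∀ p q h, Λ.d (seg p q h) = q - p
  seg_self : ∀ p, seg p p le_rfl = Λ.one (vert p)
  seg_comp : ∀ p q t (h : p ≤ q) (h' : q ≤ t),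
    Λ.comp (seg p q h) (seg q t h') = seg p t (h.trans h')

namespace InfinitePath

variable {k : ℕ} {Λ : KGraph.{u} k}

/-- The range `r(x) = x(0)`. -/
def range (x : InfinitePath Λ) : Λ.Vert := x.vert 0

/-- The initial segment `x(0, n)`. -/
def init (x : InfinitePath Λ) (n : Fin k → ℕ) : Λ.Mor := x.seg 0 n (fun i => Nat.zero_le (n i))

/-- The shift `σᵐ(x)(p, q) = x(p + m, q + m)`. -/
def shift (m : Fin k → ℕ) (x : InfinitePath Λ) : InfinitePath Λ where
  vert p := x.vert (p + m)
  seg p q h := x.seg (p + m) (q + m) (fun i => Nat.add_le_add_right (h i) (m i))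
  r_seg _ _ _ := x.r_seg _ _ _
  s_seg _ _ _ := x.s_seg _ _ _
  d_seg p q h := by
    rw [x.d_seg]
    funext i
    exact Nat.add_sub_add_right (q i) (m i) (p i)
  seg_self _ := x.seg_self _
  seg_comp _ _ _ _ _ := x.seg_comp _ _ _ _ _

/-- The cylinder set `Z(a)`. -/
def cylinder (a : Λ.Mor) : Set (InfinitePath Λ) := {x | x.init (Λ.d a) = a}

/-- The topology on `Λ^∞` generated by the cylinder sets. -/
instance : TopologicalSpace (InfinitePath Λ) :=
  TopologicalSpace.generateFrom (Set.range cylinder)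

/-- The Borel `σ`-algebra of `Λ^∞`. -/
instance : MeasurableSpace (InfinitePath Λ) := borel _

def orbit (w : InfinitePath Λ) : Set (InfinitePath Λ) :=
  {x | ∃ m l : Fin k → ℕ, shift m x = shift l w}

def Aperiodic (w : InfinitePath Λ) : Prop :=
  ∀ m n : Fin k → ℕ, m ≠ n → shift m w ≠ shift n w

end InfinitePath

/-- A Cuntz-Krieger `Λ`-family on the Hilbert space `H`, that is, a representation of `C*(Λ)`
on `H`. -/
structure CKFamily {k : ℕ} (Λ : KGraph.{u} k) (H : Type v) [NormedAddCommGroup H]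
    [InnerProductSpace ℂ H] [CompleteSpace H] where
  t : Λ.Mor → (H →L[ℂ] H)
  partial_isometry : ∀ a, t a * star (t a) * t a = t a
  proj : ∀ x, IsStarProjection (t (Λ.one x))
  orthogonal : ∀ x y, x ≠ y → t (Λ.one x) * t (Λ.one y) = 0
  mul : ∀ a b, Λ.s a = Λ.r b → t a * t b = t (Λ.comp a b)
  star_mul : ∀ a, star (t a) * t a = t (Λ.one (Λ.s a))
  sum : ∀ x n, t (Λ.one x) = ∑ᶠ a ∈ Λ.pathsTo x n, t a * star (t a)

/-- A projection valued measure on the measurable space `X` with values in the orthogonal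
projections of the Hilbert space `H`, countably additive in the strong operator topology.
Its values on non-measurable sets carry no meaning. -/
structure ProjectionValuedMeasure (X : Type u) [MeasurableSpace X] (H : Type v)
    [NormedAddCommGroup H] [InnerProductSpace ℂ H] [CompleteSpace H] where
  proj : Set X → (H →L[ℂ] H)
  isStarProjection : ∀ B, MeasurableSet B → IsStarProjection (proj B)
  proj_empty : proj ∅ = 0
  proj_univ : proj Set.univ = 1
  proj_inter : ∀ A B, MeasurableSet A → MeasurableSet B → proj (A ∩ B) = proj A * proj B
  hasSum_iUnion : ∀ B : ℕ → Set X, (∀ i, MeasurableSet (B i)) →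
    Pairwise (fun i j => Disjoint (B i) (B j)) →
    ∀ ξ : H, HasSum (fun i => proj (B i) ξ) (proj (⋃ i, B i) ξ)

namespace CKFamily

variable {k : ℕ} {Λ : KGraph.{u} k} {H : Type v} [NormedAddCommGroup H]
  [InnerProductSpace ℂ H] [CompleteSpace H]

/-- `P` is the projection valued measure of the representation: `P(Z(a)) = t_a t_a^*`.  For a
row-finite `Λ` without sources these values determine `P`. -/
def IsAssociated (T : CKFamily Λ H) (P : ProjectionValuedMeasure (InfinitePath Λ) H) : Prop :=
  ∀ a : Λ.Mor, P.proj (InfinitePath.cylinder a) = T.t a * star (T.t a)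

def IsPurelyAtomic (T : CKFamily Λ H) : Prop :=
  ∃ P : ProjectionValuedMeasure (InfinitePath Λ) H, T.IsAssociated P ∧
    ∃ Ω : Set (InfinitePath Λ), MeasurableSet Ω ∧
      P.proj Ωᶜ = 0 ∧
      (∀ w ∈ Ω, P.proj {w} ≠ 0) ∧
      ∀ ξ : H, HasSum (fun w : Ω => P.proj {(w : InfinitePath Λ)} ξ) ξ

/-- The projection valued measure of the representation vanishes off `B`. -/
def IsSupportedOn (T : CKFamily Λ H) (B : Set (InfinitePath Λ)) : Prop :=
  ∃ P : ProjectionValuedMeasure (InfinitePath Λ) H, T.IsAssociated P ∧ P.proj Bᶜ = 0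

/-- The data that make a representation permutative: an orthonormal basis `e` of `H` indexed by
`I`, sets `J a, K a ⊆ I`, and bijections `σ a : J a → K a` (the values of `σ a` off `J a` carry
no meaning).  The covering of `I` by the `J a` with `d a = n` is a separate predicate,
`CoversDomain`. -/
structure PermutativeSystem (T : CKFamily Λ H) where
  I : Type v
  e : HilbertBasis I ℂ H
  J : Λ.Mor → Set I
  K : Λ.Mor → Set I
  σ : Λ.Mor → I → I
  bijOn : ∀ a, Set.BijOn (σ a) (J a) (K a)
  iUnion_K : ∀ n : Fin k → ℕ, ⋃ a ∈ {a | Λ.d a = n}, K a = Set.univ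
  K_subset_J : ∀ a b, Λ.s a = Λ.r b → K b ⊆ J a
  J_comp : ∀ a b, Λ.s a = Λ.r b → J (Λ.comp a b) = J b
  σ_comp : ∀ a b, Λ.s a = Λ.r b → ∀ i ∈ J b, σ a (σ b i) = σ (Λ.comp a b) i
  t_apply : ∀ a, ∀ i ∈ J a, T.t a (e i) = e (σ a i)
  t_apply_zero : ∀ a, ∀ i ∉ J a, T.t a (e i) = 0
  star_apply : ∀ a, ∀ i ∈ J a, star (T.t a) (e (σ a i)) = e i
  star_apply_zero : ∀ a b, a ≠ b → Λ.d a = Λ.d b → ∀ j ∈ K b, star (T.t a) (e j) = 0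

namespace PermutativeSystem

variable {T : CKFamily Λ H}

/-- The sets `J a` with `d a = n` cover the index set. -/
def CoversDomain (S : T.PermutativeSystem) (n : Fin k → ℕ) : Prop :=
  ⋃ a ∈ {a | Λ.d a = n}, S.J a = Set.univ

/-- `E : I → Λ^∞` is the encoding map: `E(i)(0, n)` is the unique `a` of degree `n` with
`i ∈ K a`. -/
def IsEncodingMap (S : T.PermutativeSystem) (E : S.I → InfinitePath Λ) : Prop :=
  ∀ i n a, Λ.d a = n → (i ∈ S.K a ↔ (E i).init n = a)

end PermutativeSystem

/-- A decomposition of a representation as a (Hilbert space) direct sum of representations: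
`H` is the orthogonal direct sum of closed subspaces `V l`, and `rep l` is the restriction of
the representation (generators and their adjoints) to the reducing subspace `V l`. -/
structure DirectSumDecomposition (T : CKFamily Λ H) where
  ι : Type v
  V : ι → Submodule ℂ H
  complete : ∀ l, CompleteSpace (V l)
  isHilbertSum : IsHilbertSum ℂ (fun l => V l) (fun l => (V l).subtypeₗᵢ)
  rep : ∀ l, CKFamily Λ (V l)
  coe_rep : ∀ l a (x : V l), ((rep l).t a x : H) = T.t a x
  coe_star_rep : ∀ l a (x : V l), (star ((rep l).t a) x : H) = star (T.t a) x

attribute [instance] DirectSumDecomposition.complete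

end CKFamily

/-! ### Cancellation and prefixes from unique factorization. -/

namespace KGraph

variable {k : ℕ} {Λ : KGraph.{u} k}

/-! To each infinite path `x` belongs its fiber: the vectors fixed by every `t t*` along the initial
segments of `x`. It is the range of `P {x}` for any associated `P`. Fibers of distinct paths are
orthogonal; pure atomicity makes them total, and the support condition kills those off the orbit of
`w`.

If `σ^m x = σ^l w`, then `t_{x(0,m)} t_{w(0,l)}*` carries the fiber of `w` isometrically onto that
of `x`. Enlarging `m` and `l` by the same amount does not change it there, and aperiodicity
determines `m - l`, so this operator depends on `x` alone (`t_init_star_t_init_congr`). Hence the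
generators intertwine these operators: `t_a` takes the copy of a vector at `x` to its copy at `a x`
(`t_apply_transport`).

Transporting one orthonormal basis `B` of the fiber of `w` along the orbit gives a basis of `H`
indexed by orbit × `B` (`exists_orbitBasis`), on which generators prepend to the path and leave the
label in `B` alone. This is a permutative structure whose encoding map is the path coordinate.
Fixing the label gives reducing summands on which that coordinate is injective. -/

theorem comp_inj {a a' b b' : Λ.Mor} (h : Λ.s a = Λ.r b) (h' : Λ.s a' = Λ.r b')
    (hd : Λ.d a = Λ.d a') (e : Λ.comp a b = Λ.comp a' b') : a = a' ∧ b = b' := by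
  have hb : Λ.d b = Λ.d b' := by
    have := congrArg Λ.d e
    rw [Λ.d_comp _ _ h, Λ.d_comp _ _ h', hd] at this
    exact add_left_cancel this
  have := (Λ.factorization (Λ.comp a b) _ _ (Λ.d_comp _ _ h)).unique
    (y₁ := (a, b)) (y₂ := (a', b')) ⟨h, rfl, rfl, rfl⟩ ⟨h', e.symm, hd.symm, hb.symm⟩
  exact Prod.mk.inj this

theorem eq_one_of_comp_eq {a c : Λ.Mor} (h : Λ.s a = Λ.r c) (e : Λ.comp a c = a) :
    c = Λ.one (Λ.s a) :=
  (comp_inj h (Λ.r_one _).symm rfl (e.trans (Λ.comp_one a).symm)).2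

theorem exists_prefix (a : Λ.Mor) (n : Fin k → ℕ) (h : n ≤ Λ.d a) :
    ∃ b c, Λ.s b = Λ.r c ∧ Λ.comp b c = a ∧ Λ.d b = n := by
  obtain ⟨p, ⟨h1, h2, h3, -⟩, -⟩ := Λ.factorization a n (Λ.d a - n) (add_tsub_cancel_of_le h).symm
  exact ⟨p.1, p.2, h1, h2, h3⟩

end KGraph

/-! ### Infinite paths: initial segments, shifts and prepending. -/

namespace InfinitePath

variable {k : ℕ} {Λ : KGraph.{u} k}

theorem d_init (x : InfinitePath Λ) (n) : Λ.d (x.init n) = n := by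
  rw [init, x.d_seg]; exact tsub_zero n

theorem r_init (x : InfinitePath Λ) (n) : Λ.r (x.init n) = x.range := x.r_seg _ _ _

theorem s_init (x : InfinitePath Λ) (n) : Λ.s (x.init n) = x.vert n := x.s_seg _ _ _

theorem init_zero (x : InfinitePath Λ) : x.init 0 = Λ.one x.range := x.seg_self 0

theorem init_comp_seg (x : InfinitePath Λ) (p q) (h : p ≤ q) :
    Λ.comp (x.init p) (x.seg p q h) = x.init q := x.seg_comp _ _ _ _ _

theorem s_init_eq_r_seg (x : InfinitePath Λ) (p q) (h : p ≤ q) :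
    Λ.s (x.init p) = Λ.r (x.seg p q h) := by rw [s_init, r_seg]

theorem range_shift (x : InfinitePath Λ) (m) : (shift m x).range = x.vert m := by
  simp [range, shift]

theorem s_init_eq_range_shift (x : InfinitePath Λ) (m) :
    Λ.s (x.init m) = (shift m x).range := by rw [s_init, range_shift]

theorem shift_init (x : InfinitePath Λ) (m n) :
    (shift m x).init n = x.seg m (m + n) le_self_add := by
  simp [init, shift, add_comm n m]

theorem init_add (x : InfinitePath Λ) (m n) :
    Λ.comp (x.init m) ((shift m x).init n) = x.init (m + n) := by
  rw [shift_init, init_comp_seg]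

theorem init_eq_of_le {x y : InfinitePath Λ} {p q} (h : p ≤ q) (e : x.init q = y.init q) :
    x.init p = y.init p := by
  rw [← x.init_comp_seg p q h, ← y.init_comp_seg p q h] at e
  exact (KGraph.comp_inj (s_init_eq_r_seg ..) (s_init_eq_r_seg ..) (by simp [d_init]) e).1

theorem ext_init {x y : InfinitePath Λ} (e : ∀ n, x.init n = y.init n) : x = y := by
  ext p q h
  · rw [← s_init, ← s_init, e]
  · have e' := e q
    rw [← x.init_comp_seg p q h, ← y.init_comp_seg p q h] at e'
    exact (KGraph.comp_inj (s_init_eq_r_seg ..) (s_init_eq_r_seg ..) (by simp [d_init]) e').2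

theorem ext_shift {x y : InfinitePath Λ} (m) (e : x.init m = y.init m)
    (e' : shift m x = shift m y) : x = y :=
  ext_init fun n => init_eq_of_le (le_add_self : n ≤ m + n) <| by
    rw [← init_add, ← init_add, e, e']

theorem shift_shift (x : InfinitePath Λ) (m n) : shift m (shift n x) = shift (m + n) x := by
  ext p q h
  · simp [shift, add_assoc]
  · simp [shift, add_assoc]

/-- An infinite path from a compatible family of initial segments. -/
theorem exists_init_eq (f : (Fin k → ℕ) → Λ.Mor) (hd : ∀ n, Λ.d (f n) = n)
    (hf : ∀ n m, n ≤ m → ∃ c, Λ.s (f n) = Λ.r c ∧ Λ.comp (f n) c = f m) :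
    ∃ x : InfinitePath Λ, ∀ n, x.init n = f n := by
  choose c hc hfc using hf
  have hs : ∀ p q h, Λ.s (c p q h) = Λ.s (f q) := fun p q h => by
    rw [← hfc p q h, Λ.s_comp _ _ (hc p q h)]
  refine ⟨⟨fun p => Λ.s (f p), c, fun p q h => (hc p q h).symm, hs, fun p q h => ?_,
    fun p => KGraph.eq_one_of_comp_eq (hc _ _ _) (hfc _ _ _), fun p q t h h' => ?_⟩, fun n => ?_⟩
  · have := congrArg Λ.d (hfc p q h)
    rw [Λ.d_comp _ _ (hc p q h), hd, hd] at this
    exact eq_tsub_of_add_eq (by rw [add_comm, this])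
  · have h1 : Λ.s (c p q h) = Λ.r (c q t h') := (hs p q h).trans (hc _ _ _)
    refine (KGraph.comp_inj (a := f p) (a' := f p) ?_ (hc _ _ _) rfl ?_).2
    · rw [Λ.r_comp _ _ h1, ← hc]
    · rw [← Λ.comp_assoc _ _ _ (hc _ _ _) h1, hfc, hfc, hfc]
  -- Degree zero forces an identity: compare the factorizations `f 0 · 1` and `1 · f 0`.
  · have h1 : f 0 = Λ.one (Λ.r (f 0)) := by
      refine (KGraph.comp_inj (b := Λ.one (Λ.s (f 0))) (b' := f 0) (Λ.r_one _).symm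
        (Λ.s_one _) ?_ ?_).1
      · rw [hd, Λ.d_one]
      · rw [Λ.comp_one, Λ.one_comp]
    have h2 : Λ.r (c 0 n (fun i => Nat.zero_le (n i))) = Λ.r (f 0) := by
      rw [← hc, h1, Λ.s_one, Λ.r_one]
    change c 0 n _ = f n
    rw [← hfc 0 n (fun i => Nat.zero_le (n i)), h1, ← h2, Λ.one_comp]

/-- The segment of degree `n` of `a x` is cut out of `a x(0,n)`, whose degree `d a + n` is large
enough. -/
theorem exists_prepend (a : Λ.Mor) (x : InfinitePath Λ) (h : Λ.s a = x.range) :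
    ∃ y : InfinitePath Λ, y.init (Λ.d a) = a ∧ shift (Λ.d a) y = x := by
  have hr : ∀ n, Λ.s a = Λ.r (x.init n) := fun n => h.trans (x.r_init n).symm
  have hle : ∀ n, n ≤ Λ.d (Λ.comp a (x.init n)) := fun n => by
    rw [Λ.d_comp _ _ (hr n), d_init]; exact le_add_self
  choose f c hfc he hd using fun n => KGraph.exists_prefix _ n (hle n)
  have hx : ∀ n m, n ≤ m → ∃ c, Λ.s (Λ.comp a (x.init n)) = Λ.r c ∧
      Λ.comp (Λ.comp a (x.init n)) c = Λ.comp a (x.init m) := fun n m hnm =>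
    ⟨x.seg n m hnm, by rw [Λ.s_comp _ _ (hr n), s_init_eq_r_seg], by
      rw [Λ.comp_assoc _ _ _ (hr n) (s_init_eq_r_seg ..), init_comp_seg]⟩
  -- Cutting at a later stage `m` gives the same prefix, because `a x(0,m)` extends `a x(0, d b)`.
  have key : ∀ b e m, Λ.s b = Λ.r e → Λ.d b ≤ m → Λ.comp b e = Λ.comp a (x.init m) →
      f (Λ.d b) = b := by
    intro b e m hbe hbm heq
    obtain ⟨e', h1, h2⟩ := hx _ m hbm
    have h3 : Λ.s (c (Λ.d b)) = Λ.r e' := by rw [← h1, ← he, Λ.s_comp _ _ (hfc _)]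
    refine (KGraph.comp_inj (b := Λ.comp (c (Λ.d b)) e') ?_ hbe (hd _) ?_).1
    · rw [Λ.r_comp _ _ h3, hfc]
    · rw [heq, ← h2, ← he (Λ.d b), Λ.comp_assoc _ _ _ (hfc _) h3]
  obtain ⟨y, hy⟩ := exists_init_eq f hd fun n m hnm => by
    obtain ⟨b, e, h1, h2, h3⟩ := KGraph.exists_prefix (f m) n (by rwa [hd])
    have h4 : Λ.s e = Λ.r (c m) := by rw [← hfc, ← h2, Λ.s_comp _ _ h1]
    have : f n = b := by
      subst h3
      refine key b (Λ.comp e (c m)) m (by rw [Λ.r_comp _ _ h4, h1]) hnm ?_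
      rw [← Λ.comp_assoc _ _ _ h1 h4, h2, he]
    exact ⟨e, this ▸ h1, this ▸ h2⟩
  have hya : y.init (Λ.d a) = a := by
    rw [hy]; exact key a _ _ (hr _) le_rfl rfl
  refine ⟨y, hya, ext_init fun n => ?_⟩
  refine (KGraph.comp_inj (a := y.init (Λ.d a)) (a' := a) ?_ (hr n) (d_init _ _) ?_).2
  · rw [s_init_eq_range_shift, r_init]
  · rw [init_add, hy]
    have hdn : Λ.d (Λ.comp a (x.init n)) = Λ.d a + n := by rw [Λ.d_comp _ _ (hr n), d_init]
    obtain ⟨e, h1, h2⟩ := hx n (Λ.d a + n) le_add_self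
    rw [← hdn]
    exact key _ e _ h1 hdn.le h2

/-! ### Orbits and measurability. -/

theorem shift_mem_orbit {w x : InfinitePath Λ} (n) (h : x ∈ w.orbit) : shift n x ∈ w.orbit := by
  obtain ⟨m, l, h⟩ := h
  exact ⟨m, n + l, by rw [shift_shift, add_comm, ← shift_shift, h, shift_shift]⟩

theorem mem_orbit_of_shift {w x : InfinitePath Λ} (n) (h : shift n x ∈ w.orbit) :
    x ∈ w.orbit := by
  obtain ⟨m, l, h⟩ := h
  exact ⟨m + n, l, by rw [← shift_shift, h]⟩

/-- For fixed `m` and `l`, a path with `σ^m x = σ^l w` is determined by `x(0,m)`, and `Λ` is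
countable. -/
theorem countable_orbit (w : InfinitePath Λ) : w.orbit.Countable := by
  have : w.orbit = ⋃ (m) (l), {x | shift m x = shift l w} := by
    ext x; simp [orbit]
  rw [this]
  refine Set.countable_iUnion fun m => Set.countable_iUnion fun l => ?_
  have := Λ.countable_mor
  refine Set.MapsTo.countable_of_injOn (f := fun x => x.init m) (t := Set.univ)
    (fun _ _ => trivial) (fun x hx y hy e => ?_) Set.countable_univ
  exact ext_shift m e (hx.trans hy.symm)

theorem mem_cylinder_init {x y : InfinitePath Λ} {n} :
    y ∈ cylinder (x.init n) ↔ y.init n = x.init n := by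
  rw [cylinder, Set.mem_ofPred_eq, d_init]

theorem measurableSet_cylinder (a : Λ.Mor) : MeasurableSet (cylinder a) :=
  MeasurableSpace.measurableSet_generateFrom
    (TopologicalSpace.isOpen_generateFrom_of_mem (Set.mem_range_self a))

theorem singleton_eq_iInter_cylinder (x : InfinitePath Λ) :
    {x} = ⋂ n : ℕ, cylinder (x.init fun _ => n) := by
  ext y
  simp only [Set.mem_singleton_iff, Set.mem_iInter, mem_cylinder_init]
  refine ⟨fun h n => h ▸ rfl, fun h => ext_init fun n => ?_⟩
  -- Constant degrees are cofinal: `n` lies below the constant `∑ i, n i`.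
  exact init_eq_of_le (fun i => Finset.single_le_sum (f := n) (fun _ _ => Nat.zero_le _)
    (Finset.mem_univ i)) (h (∑ i, n i))

theorem measurableSet_singleton (x : InfinitePath Λ) : MeasurableSet {x} := by
  rw [singleton_eq_iInter_cylinder]
  exact .iInter fun n => measurableSet_cylinder _

theorem measurableSet_orbit (w : InfinitePath Λ) : MeasurableSet w.orbit := by
  rw [← Set.biUnion_of_singleton w.orbit]
  exact .biUnion w.countable_orbit fun x _ => measurableSet_singleton x

end InfinitePath

/-! ### Null sets and sets of full measure for a single vector. -/

namespace ProjectionValuedMeasure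

variable {X : Type u} [MeasurableSpace X] {H : Type v} [NormedAddCommGroup H]
  [InnerProductSpace ℂ H] [CompleteSpace H] (P : ProjectionValuedMeasure X H)

theorem proj_add_compl {A : Set X} (hA : MeasurableSet A) (ξ : H) :
    P.proj A ξ + P.proj Aᶜ ξ = ξ := by
  have h := P.hasSum_iUnion (fun n => if n = 0 then A else if n = 1 then Aᶜ else ∅)
    (fun i => by split_ifs <;> simp [hA]) (fun i j hij => by
      dsimp only [Function.onFun]; split_ifs <;> simp_all [disjoint_compl_right, disjoint_compl_left]) ξ
  have hU : (⋃ n : ℕ, if n = 0 then A else if n = 1 then Aᶜ else ∅) = Set.univ := by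
    refine Set.eq_univ_of_forall fun x => Set.mem_iUnion.2 ?_
    by_cases hx : x ∈ A
    · exact ⟨0, by simpa⟩
    · exact ⟨1, by simpa⟩
  rw [hU, P.proj_univ] at h
  refine (h.unique ?_).symm
  have h2 := hasSum_sum_of_ne_finset_zero (s := Finset.range 2) (f := fun n : ℕ =>
      P.proj (if n = 0 then A else if n = 1 then Aᶜ else ∅) ξ)
    (L := .unconditional ℕ) fun n hn => by
      simp only [Finset.mem_range, not_lt] at hn
      rw [if_neg (by omega), if_neg (by omega), P.proj_empty]; rfl
  simpa [Finset.sum_range_succ] using h2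

theorem proj_compl_apply_eq_zero_iff {A : Set X} (hA : MeasurableSet A) (ξ : H) :
    P.proj Aᶜ ξ = 0 ↔ P.proj A ξ = ξ := by
  have := P.proj_add_compl hA ξ
  constructor
  · intro h; rwa [h, add_zero] at this
  · intro h; rwa [h, add_eq_left] at this

theorem proj_apply_eq_zero_of_subset {A B : Set X} (hA : MeasurableSet A) (hB : MeasurableSet B)
    (h : A ⊆ B) {ξ : H} (hξ : P.proj B ξ = 0) : P.proj A ξ = 0 := by
  rw [← Set.inter_eq_self_of_subset_left h, P.proj_inter _ _ hA hB,
    mul_apply_eq_comp, hξ, map_zero]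

theorem proj_iUnion_apply_eq_zero {A : ℕ → Set X} (hA : ∀ n, MeasurableSet (A n)) {ξ : H}
    (h : ∀ n, P.proj (A n) ξ = 0) : P.proj (⋃ n, A n) ξ = 0 := by
  have hm : ∀ n, MeasurableSet (disjointed A n) := fun n => .disjointed hA n
  have hs := P.hasSum_iUnion _ hm (disjoint_disjointed A) ξ
  rw [iUnion_disjointed] at hs
  refine hs.unique ?_
  convert hasSum_zero using 2 with n
  exact P.proj_apply_eq_zero_of_subset (hm n) (hA n) (disjointed_subset A n) (h n)

theorem proj_iInter_apply_eq_self {A : ℕ → Set X} (hA : ∀ n, MeasurableSet (A n)) {ξ : H}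
    (h : ∀ n, P.proj (A n) ξ = ξ) : P.proj (⋂ n, A n) ξ = ξ := by
  rw [← P.proj_compl_apply_eq_zero_iff (.iInter hA), Set.compl_iInter]
  exact P.proj_iUnion_apply_eq_zero (fun n => (hA n).compl)
    fun n => (P.proj_compl_apply_eq_zero_iff (hA n) ξ).2 (h n)

end ProjectionValuedMeasure

/-! ### Fibers of the representation over infinite paths. -/

namespace CKFamily

open InfinitePath

variable {k : ℕ} {Λ : KGraph.{u} k} {H : Type v} [NormedAddCommGroup H]
  [InnerProductSpace ℂ H] [CompleteSpace H] (T : CKFamily Λ H)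

theorem t_mul_t_apply {a b : Λ.Mor} (h : Λ.s a = Λ.r b) (ξ : H) :
    T.t a (T.t b ξ) = T.t (Λ.comp a b) ξ := by
  rw [← T.mul a b h]; rfl

theorem star_t_apply_star_t_apply {a b : Λ.Mor} (h : Λ.s a = Λ.r b) (ξ : H) :
    star (T.t b) (star (T.t a) ξ) = star (T.t (Λ.comp a b)) ξ := by
  rw [← T.mul a b h, StarMul.star_mul]; rfl

theorem star_t_apply_t_apply (a : Λ.Mor) (ξ : H) :
    star (T.t a) (T.t a ξ) = T.t (Λ.one (Λ.s a)) ξ := by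
  rw [← T.star_mul a]; rfl

theorem t_star_t_apply_t_apply (a : Λ.Mor) (ξ : H) :
    T.t a (star (T.t a) (T.t a ξ)) = T.t a ξ :=
  congrArg (fun A : H →L[ℂ] H => A ξ) (T.partial_isometry a)

theorem star_t_one (x : Λ.Vert) : star (T.t (Λ.one x)) = T.t (Λ.one x) :=
  (T.proj x).isSelfAdjoint

theorem t_one_apply_t_apply (a : Λ.Mor) (ξ : H) :
    T.t (Λ.one (Λ.r a)) (T.t a ξ) = T.t a ξ := by
  rw [t_mul_t_apply _ (Λ.s_one _), Λ.one_comp]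

theorem t_apply_t_one_apply (a : Λ.Mor) (ξ : H) :
    T.t a (T.t (Λ.one (Λ.s a)) ξ) = T.t a ξ := by
  rw [t_mul_t_apply _ (Λ.r_one _).symm, Λ.comp_one]

theorem t_star_t_apply_of_comp {a b : Λ.Mor} (h : Λ.s a = Λ.r b) {ξ : H}
    (hξ : T.t (Λ.comp a b) (star (T.t (Λ.comp a b)) ξ) = ξ) : T.t a (star (T.t a) ξ) = ξ := by
  rw [← hξ, ← T.t_mul_t_apply h, t_star_t_apply_t_apply]

/-- The vectors carried by the single infinite path `x`. -/
noncomputable def fiber (x : InfinitePath Λ) : Submodule ℂ H :=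
  ⨅ n, (T.t (x.init n) * star (T.t (x.init n))).eqLocus (1 : H →L[ℂ] H)

variable {T}

theorem mem_fiber {x : InfinitePath Λ} {ξ : H} :
    ξ ∈ T.fiber x ↔ ∀ n, T.t (x.init n) (star (T.t (x.init n)) ξ) = ξ := by
  simp only [fiber, Submodule.mem_iInf]; rfl

/-- The projections decrease along `x`, so it suffices to test cofinally many degrees. -/
theorem mem_fiber_of_add {x : InfinitePath Λ} {ξ : H} (m)
    (h : ∀ n, T.t (x.init (m + n)) (star (T.t (x.init (m + n))) ξ) = ξ) : ξ ∈ T.fiber x := by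
  refine mem_fiber.2 fun n => ?_
  have hn := h n
  rw [← x.init_comp_seg n (m + n) le_add_self] at hn
  exact T.t_star_t_apply_of_comp (s_init_eq_r_seg ..) hn

theorem t_one_apply_of_mem_fiber {x : InfinitePath Λ} {ξ : H} (h : ξ ∈ T.fiber x) :
    T.t (Λ.one x.range) ξ = ξ := by
  have := mem_fiber.1 h 0
  rw [init_zero] at this
  rw [← this, T.t_mul_t_apply (by rw [Λ.s_one, Λ.r_one])]
  congr 2
  simpa [Λ.r_one] using Λ.one_comp (Λ.one x.range)

theorem star_t_apply_t_apply_of_mem_fiber {x : InfinitePath Λ} {ξ : H} (h : ξ ∈ T.fiber x)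
    {a : Λ.Mor} (ha : Λ.s a = x.range) : star (T.t a) (T.t a ξ) = ξ := by
  rw [star_t_apply_t_apply, ha, t_one_apply_of_mem_fiber h]

/-- Together with `star_t_init_apply_mem_fiber`: adding and removing `y(0,m)` exchange the fibers of
`σ^m y` and `y`. -/
theorem t_init_apply_mem_fiber {y : InfinitePath Λ} (m) {ξ : H} (h : ξ ∈ T.fiber (shift m y)) :
    T.t (y.init m) ξ ∈ T.fiber y := by
  refine mem_fiber_of_add m fun n => ?_
  have hs : Λ.s (y.init m) = Λ.r ((shift m y).init n) := by rw [r_init, s_init_eq_range_shift]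
  rw [← init_add, ← T.star_t_apply_star_t_apply hs, ← T.t_mul_t_apply hs,
    star_t_apply_t_apply_of_mem_fiber h (s_init_eq_range_shift _ _), mem_fiber.1 h]

theorem star_t_init_apply_mem_fiber {y : InfinitePath Λ} (m) {ξ : H} (h : ξ ∈ T.fiber y) :
    star (T.t (y.init m)) ξ ∈ T.fiber (shift m y) := by
  refine mem_fiber.2 fun n => ?_
  have hs : Λ.s (y.init m) = Λ.r ((shift m y).init n) := by rw [r_init, s_init_eq_range_shift]
  have := congrArg (⇑(star (T.t (y.init m)))) (mem_fiber.1 h (m + n))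
  rwa [← init_add, ← T.star_t_apply_star_t_apply hs, ← T.t_mul_t_apply hs,
    star_t_apply_t_apply, hs, t_one_apply_t_apply] at this

theorem t_apply_eq_zero_of_mem_fiber {x : InfinitePath Λ} {ξ : H} (h : ξ ∈ T.fiber x)
    {a : Λ.Mor} (ha : Λ.s a ≠ x.range) : T.t a ξ = 0 := by
  rw [← T.t_apply_t_one_apply, ← t_one_apply_of_mem_fiber h]
  have : T.t (Λ.one (Λ.s a)) (T.t (Λ.one x.range) ξ) = 0 :=
    congrArg (fun A : H →L[ℂ] H => A ξ) (T.orthogonal _ _ ha)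
  rw [this, map_zero]

variable {P : ProjectionValuedMeasure (InfinitePath Λ) H}

theorem IsAssociated.proj_cylinder_apply (hP : T.IsAssociated P) (a : Λ.Mor) (ξ : H) :
    P.proj (cylinder a) ξ = T.t a (star (T.t a) ξ) := by
  rw [hP]; rfl

/-- Distinct paths of equal degree have disjoint cylinders, so `t_a t_a*` kills the range of `t_b`;
then `‖t_a* η‖² = ⟪η, t_a t_a* η⟫` removes the outer `t_a`. -/
theorem IsAssociated.star_t_apply_t_apply_eq_zero (hP : T.IsAssociated P) {a b : Λ.Mor}
    (hd : Λ.d a = Λ.d b) (hab : a ≠ b) (ξ : H) : star (T.t a) (T.t b ξ) = 0 := by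
  have hdis : cylinder a ∩ cylinder b = (∅ : Set (InfinitePath Λ)) := by
    refine Set.eq_empty_of_forall_notMem fun x hx => hab ?_
    have h1 : x.init (Λ.d a) = a := hx.1
    have h2 : x.init (Λ.d b) = b := hx.2
    rw [← h1, hd, h2]
  have h0 : T.t a (star (T.t a) (T.t b ξ)) = 0 := by
    rw [← T.t_star_t_apply_t_apply b, ← hP.proj_cylinder_apply b, ← hP.proj_cylinder_apply a,
      ← mul_apply_eq_comp, ← P.proj_inter _ _ (measurableSet_cylinder a)
      (measurableSet_cylinder b), hdis, P.proj_empty]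
    rfl
  rw [← norm_eq_zero, ← sq_eq_zero_iff, ← inner_self_eq_norm_sq (𝕜 := ℂ),
    ContinuousLinearMap.star_eq_adjoint, ContinuousLinearMap.adjoint_inner_left,
    ← ContinuousLinearMap.star_eq_adjoint, h0, inner_zero_right, map_zero]

theorem IsAssociated.star_t_apply_eq_zero_of_mem_fiber (hP : T.IsAssociated P)
    {x : InfinitePath Λ} {ξ : H} (h : ξ ∈ T.fiber x) {a : Λ.Mor} (ha : x.init (Λ.d a) ≠ a) :
    star (T.t a) ξ = 0 := by
  rw [← mem_fiber.1 h (Λ.d a)]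
  exact hP.star_t_apply_t_apply_eq_zero (d_init _ _).symm ha.symm _

theorem IsAssociated.inner_eq_zero_of_mem_fiber (hP : T.IsAssociated P) {x y : InfinitePath Λ}
    (hxy : x ≠ y) {ξ η : H} (hξ : ξ ∈ T.fiber x) (hη : η ∈ T.fiber y) : ⟪ξ, η⟫_ℂ = 0 := by
  obtain ⟨n, hn⟩ : ∃ n, x.init n ≠ y.init n := by
    by_contra! h
    exact hxy (ext_init h)
  rw [← mem_fiber.1 hξ n, ← ContinuousLinearMap.adjoint_inner_right,
    ← ContinuousLinearMap.star_eq_adjoint,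
    hP.star_t_apply_eq_zero_of_mem_fiber hη (by rwa [d_init, ne_comm]), inner_zero_right]

/-- A singleton is a countable intersection of cylinders, whose projections are prescribed. Since
`fiber` does not mention `P`, this reconciles the possibly different measures supplied by pure
atomicity and by the support condition. -/
theorem IsAssociated.proj_singleton_apply_eq_self_iff (hP : T.IsAssociated P)
    {x : InfinitePath Λ} {ξ : H} : P.proj {x} ξ = ξ ↔ ξ ∈ T.fiber x := by
  constructor
  · refine fun h => mem_fiber.2 fun n => ?_
    rw [← hP.proj_cylinder_apply]
    nth_rw 1 [← h]
    rw [← mul_apply_eq_comp, ← P.proj_inter _ _ (measurableSet_cylinder _)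
      (measurableSet_singleton x), Set.inter_eq_self_of_subset_right, h]
    rw [Set.singleton_subset_iff, mem_cylinder_init]
  · intro h
    rw [singleton_eq_iInter_cylinder]
    refine P.proj_iInter_apply_eq_self (fun n => measurableSet_cylinder _) fun n => ?_
    rw [hP.proj_cylinder_apply, mem_fiber.1 h]

theorem IsAssociated.proj_singleton_apply_mem_fiber (hP : T.IsAssociated P)
    (x : InfinitePath Λ) (ξ : H) : P.proj {x} ξ ∈ T.fiber x := by
  rw [← hP.proj_singleton_apply_eq_self_iff, ← mul_apply_eq_comp,
    (P.isStarProjection _ (measurableSet_singleton x)).isIdempotentElem.eq]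

theorem fiber_eq_bot_of_notMem {w x : InfinitePath Λ} (hs : T.IsSupportedOn w.orbit)
    (hx : x ∉ w.orbit) : T.fiber x = ⊥ := by
  obtain ⟨Q, hQ, h0⟩ := hs
  refine (Submodule.eq_bot_iff _).2 fun ξ hξ => ?_
  rw [← hQ.proj_singleton_apply_eq_self_iff.2 hξ]
  exact Q.proj_apply_eq_zero_of_subset (measurableSet_singleton x) w.measurableSet_orbit.compl
    (Set.singleton_subset_iff.2 hx) (by rw [h0]; rfl)

/-- Totality of the orbit fibers: `η` is the sum of its components `P {x} η`, each in a fiber, so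
`⟪η, η⟫` is a sum of zeros. -/
theorem eq_zero_of_forall_inner_fiber {w : InfinitePath Λ} (hT : T.IsPurelyAtomic)
    (hs : T.IsSupportedOn w.orbit) {η : H}
    (h : ∀ x ∈ w.orbit, ∀ ξ ∈ T.fiber x, ⟪η, ξ⟫_ℂ = 0) : η = 0 := by
  obtain ⟨P, hP, Ω, -, -, -, hsum⟩ := hT
  have h1 := (hsum η).mapL (innerSL ℂ η)
  have h2 : (fun x : Ω => innerSL ℂ η (P.proj {(x : InfinitePath Λ)} η)) = fun _ => 0 := by
    funext x
    have hm := hP.proj_singleton_apply_mem_fiber x η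
    by_cases hx : (x : InfinitePath Λ) ∈ w.orbit
    · exact h x hx _ hm
    · rw [fiber_eq_bot_of_notMem hs hx, Submodule.mem_bot] at hm
      rw [hm, map_zero]
  rw [h2] at h1
  exact inner_self_eq_zero.1 (h1.unique hasSum_zero)

theorem isClosed_fiber (x : InfinitePath Λ) : IsClosed (T.fiber x : Set H) := by
  have : (T.fiber x : Set H) = ⋂ n, {ξ | T.t (x.init n) (star (T.t (x.init n)) ξ) = ξ} := by
    ext ξ; simp [mem_fiber]
  rw [this]
  exact isClosed_iInter fun n => isClosed_eq (by fun_prop) continuous_id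

end CKFamily

/-! ### Prepending within an orbit, and the lag of a path relative to `w`. -/

namespace InfinitePath

variable {k : ℕ} {Λ : KGraph.{u} k}

theorem exists_prepend_orbit {w : InfinitePath Λ} (a : Λ.Mor) (x : w.orbit) :
    ∃ y : w.orbit, Λ.s a = x.1.range → y.1.init (Λ.d a) = a ∧ x.1 = shift (Λ.d a) y.1 := by
  by_cases h : Λ.s a = x.1.range
  · obtain ⟨y, h1, h2⟩ := exists_prepend a x.1 h
    exact ⟨⟨y, mem_orbit_of_shift (Λ.d a) (h2 ▸ x.2)⟩, fun _ => ⟨h1, h2.symm⟩⟩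
  · exact ⟨x, fun h' => absurd h' h⟩

/-- The path `a x` in the orbit of `w`; its value carries no meaning unless `s a = r x`. -/
noncomputable def prepend {w : InfinitePath Λ} (a : Λ.Mor) (x : w.orbit) : w.orbit :=
  (exists_prepend_orbit a x).choose

variable {w : InfinitePath Λ}

theorem init_prepend {a : Λ.Mor} {x : w.orbit} (h : Λ.s a = x.1.range) :
    (prepend a x).1.init (Λ.d a) = a := ((exists_prepend_orbit a x).choose_spec h).1

theorem shift_prepend {a : Λ.Mor} {x : w.orbit} (h : Λ.s a = x.1.range) :
    shift (Λ.d a) (prepend a x).1 = x.1 := ((exists_prepend_orbit a x).choose_spec h).2.symm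

theorem source_eq_range_shift {a : Λ.Mor} {y : InfinitePath Λ} (h : y.init (Λ.d a) = a) :
    Λ.s a = (shift (Λ.d a) y).range := by
  rw [← s_init_eq_range_shift, h]

theorem eq_prepend {a : Λ.Mor} {x y : w.orbit} (h : y.1.init (Λ.d a) = a)
    (h' : shift (Λ.d a) y.1 = x.1) : prepend a x = y := by
  have hs : Λ.s a = x.1.range := h' ▸ source_eq_range_shift h
  exact Subtype.ext (ext_shift (Λ.d a) ((init_prepend hs).trans h.symm)
    ((shift_prepend hs).trans h'.symm))

theorem range_prepend {a : Λ.Mor} {x : w.orbit} (h : Λ.s a = x.1.range) :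
    (prepend a x).1.range = Λ.r a := by
  rw [← r_init _ (Λ.d a), init_prepend h]

theorem prepend_comp {a b : Λ.Mor} (hab : Λ.s a = Λ.r b) {x : w.orbit}
    (h : Λ.s b = x.1.range) : prepend a (prepend b x) = prepend (Λ.comp a b) x := by
  have ha : Λ.s a = (prepend b x).1.range := by rw [range_prepend h, hab]
  refine (eq_prepend ?_ ?_).symm
  · rw [Λ.d_comp _ _ hab, ← init_add, shift_prepend ha, init_prepend ha, init_prepend h]
  · rw [Λ.d_comp _ _ hab, add_comm, ← shift_shift, shift_prepend ha, shift_prepend h]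

theorem exists_shift_eq_shift (x : w.orbit) :
    ∃ p : (Fin k → ℕ) × (Fin k → ℕ), shift p.1 x.1 = shift p.2 w := by
  obtain ⟨m, l, h⟩ := x.2
  exact ⟨(m, l), h⟩

/-- A choice of degrees witnessing that a path lies in the orbit of `w`. -/
noncomputable def tailIndex (x : w.orbit) : (Fin k → ℕ) × (Fin k → ℕ) :=
  (exists_shift_eq_shift x).choose

theorem shift_tailIndex (x : w.orbit) : shift (tailIndex x).1 x.1 = shift (tailIndex x).2 w :=
  (exists_shift_eq_shift x).choose_spec

/-- The lag `m - l` is well defined, stated additively in `ℕ^k`: both sums shift `w` to the same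
path `σ^(m + m') x`. -/
theorem Aperiodic.add_eq_add (hw : w.Aperiodic) {x : InfinitePath Λ} {m l m' l' : Fin k → ℕ}
    (h : shift m x = shift l w) (h' : shift m' x = shift l' w) : m' + l = m + l' := by
  by_contra hne
  refine hw _ _ hne ?_
  rw [← shift_shift, ← h, ← shift_shift, ← h', shift_shift, shift_shift, add_comm]

end InfinitePath

/-! ### Transport from the fiber of `w` along its orbit. -/

namespace CKFamily

open InfinitePath

variable {k : ℕ} {Λ : KGraph.{u} k} {H : Type v} [NormedAddCommGroup H]
  [InnerProductSpace ℂ H] [CompleteSpace H] {T : CKFamily Λ H}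

/-- The extra degree inserts `t_c t_c*` with `c = (σ^l w)(0,p)`, which fixes the fiber of `σ^l w`.
-/
theorem t_init_star_t_init_add {w x : InfinitePath Λ} {m l : Fin k → ℕ}
    (h : shift m x = shift l w) (p) {ξ : H} (hξ : ξ ∈ T.fiber w) :
    T.t (x.init (m + p)) (star (T.t (w.init (l + p))) ξ) =
      T.t (x.init m) (star (T.t (w.init l)) ξ) := by
  have h1 : Λ.s (x.init m) = Λ.r ((shift l w).init p) := by
    rw [s_init_eq_range_shift, h, r_init]
  have h2 : Λ.s (w.init l) = Λ.r ((shift l w).init p) := by rw [s_init_eq_range_shift, r_init]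
  rw [← init_add, ← init_add, h, ← T.t_mul_t_apply h1, ← T.star_t_apply_star_t_apply h2,
    mem_fiber.1 (star_t_init_apply_mem_fiber l hξ)]

/-- Raise the first pair by `m'` and the second by `m`: the degrees on `x` then agree, and those on
`w` agree by aperiodicity. -/
theorem t_init_star_t_init_congr {w x : InfinitePath Λ} (hw : w.Aperiodic)
    {m l m' l' : Fin k → ℕ} (h : shift m x = shift l w) (h' : shift m' x = shift l' w) {ξ : H}
    (hξ : ξ ∈ T.fiber w) :
    T.t (x.init m) (star (T.t (w.init l)) ξ) = T.t (x.init m') (star (T.t (w.init l')) ξ) := by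
  rw [← t_init_star_t_init_add h m' hξ, ← t_init_star_t_init_add h' m hξ, add_comm m' m,
    add_comm l, hw.add_eq_add h h', add_comm l']

variable (T) in
/-- The canonical operator from the fiber of `w` to the fiber of a path in its orbit. -/
noncomputable def transport {w : InfinitePath Λ} (x : w.orbit) : H →L[ℂ] H :=
  T.t (x.1.init (tailIndex x).1) * star (T.t (w.init (tailIndex x).2))

variable {w : InfinitePath Λ}

theorem transport_apply (hw : w.Aperiodic) {x : w.orbit} {m l : Fin k → ℕ} (h : shift m x.1 = shift l w) {ξ : H}
    (hξ : ξ ∈ T.fiber w) :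
    T.transport x ξ = T.t (x.1.init m) (star (T.t (w.init l)) ξ) :=
  t_init_star_t_init_congr hw (shift_tailIndex x) h hξ

theorem transport_mem_fiber (x : w.orbit) {ξ : H} (hξ : ξ ∈ T.fiber w) :
    T.transport x ξ ∈ T.fiber x.1 := by
  refine t_init_apply_mem_fiber _ ?_
  rw [shift_tailIndex x]
  exact star_t_init_apply_mem_fiber _ hξ

theorem adjoint_transport_mem_fiber (x : w.orbit) {ξ : H} (hξ : ξ ∈ T.fiber x.1) :
    star (T.transport x) ξ ∈ T.fiber w := by
  rw [transport, StarMul.star_mul, star_star]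
  refine t_init_apply_mem_fiber _ ?_
  rw [← shift_tailIndex x]
  exact star_t_init_apply_mem_fiber _ hξ

theorem adjoint_transport_transport (x : w.orbit) {ξ : H} (hξ : ξ ∈ T.fiber w) :
    star (T.transport x) (T.transport x ξ) = ξ := by
  have h := shift_tailIndex x
  have h1 := star_t_init_apply_mem_fiber (tailIndex x).2 hξ
  rw [transport, StarMul.star_mul, star_star]
  simp only [mul_apply_eq_comp]
  rw [star_t_apply_t_apply_of_mem_fiber h1, mem_fiber.1 hξ]
  rw [s_init_eq_range_shift, h]

theorem transport_adjoint_transport (x : w.orbit) {ξ : H} (hξ : ξ ∈ T.fiber x.1) :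
    T.transport x (star (T.transport x) ξ) = ξ := by
  have h := shift_tailIndex x
  have h1 := star_t_init_apply_mem_fiber (tailIndex x).1 hξ
  rw [transport, StarMul.star_mul, star_star]
  simp only [mul_apply_eq_comp]
  rw [star_t_apply_t_apply_of_mem_fiber h1, mem_fiber.1 hξ]
  rw [s_init_eq_range_shift, h]

theorem inner_transport_transport (x : w.orbit) {ξ η : H}
    (hη : η ∈ T.fiber w) : ⟪T.transport x ξ, T.transport x η⟫_ℂ = ⟪ξ, η⟫_ℂ := by
  rw [← ContinuousLinearMap.adjoint_inner_right, ← ContinuousLinearMap.star_eq_adjoint,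
    adjoint_transport_transport x hη]

/-- If `(m, l)` witnesses that `x` is in the orbit, `(d a + m, l)` does so for `y = a x`;
independence of the witness turns this into the claim. -/
theorem t_apply_transport (hw : w.Aperiodic) {a : Λ.Mor} {x y : w.orbit} (h : y.1.init (Λ.d a) = a)
    (h' : x.1 = shift (Λ.d a) y.1) {ξ : H} (hξ : ξ ∈ T.fiber w) :
    T.t a (T.transport x ξ) = T.transport y ξ := by
  obtain ⟨m, l, hml⟩ := x.2
  have hy : shift (Λ.d a + m) y.1 = shift l w := by
    rw [add_comm, ← shift_shift, ← h', hml]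
  rw [transport_apply hw hml hξ, transport_apply hw hy hξ, ← init_add, h, ← h',
    T.t_mul_t_apply]
  rw [r_init, h', source_eq_range_shift h]

theorem star_t_apply_transport (hw : w.Aperiodic) {a : Λ.Mor} {x y : w.orbit} (h : y.1.init (Λ.d a) = a)
    (h' : x.1 = shift (Λ.d a) y.1) {ξ : H} (hξ : ξ ∈ T.fiber w) :
    star (T.t a) (T.transport y ξ) = T.transport x ξ := by
  rw [← t_apply_transport hw h h' hξ]
  exact star_t_apply_t_apply_of_mem_fiber (transport_mem_fiber x hξ)
    (h' ▸ source_eq_range_shift h)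

variable (T) in
/-- An orthonormal basis indexed by the orbit of `w` and a multiplicity set `B`, on which the
generators act by prepending to the path. -/
structure OrbitBasis (w : InfinitePath Λ) (X B : Type v) where
  path : X ≃ w.orbit
  e : HilbertBasis (X × B) ℂ H
  t_apply : ∀ a x y b, (path y).1.init (Λ.d a) = a → (path x).1 = shift (Λ.d a) (path y).1 →
    T.t a (e (x, b)) = e (y, b)
  star_t_apply : ∀ a x y b, (path y).1.init (Λ.d a) = a →
    (path x).1 = shift (Λ.d a) (path y).1 → star (T.t a) (e (y, b)) = e (x, b)
  t_apply_zero : ∀ a x b, Λ.s a ≠ (path x).1.range → T.t a (e (x, b)) = 0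
  star_t_apply_zero : ∀ a x b, (path x).1.init (Λ.d a) ≠ a → star (T.t a) (e (x, b)) = 0

/-! ### The permutative structure carried by an orbit basis. -/

namespace OrbitBasis

variable {w : InfinitePath Λ} {X B : Type v} (β : T.OrbitBasis w X B)

/-- The permutative structure given by prepending to paths. -/
noncomputable def permutativeSystem : T.PermutativeSystem where
  I := X × B
  e := β.e
  J a := {i | Λ.s a = (β.path i.1).1.range}
  K a := {i | (β.path i.1).1.init (Λ.d a) = a}
  σ a i := (β.path.symm (prepend a (β.path i.1)), i.2)
  bijOn a := by
    refine ⟨fun i hi => ?_, fun i hi j hj hij => ?_, fun i hi => ?_⟩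
    · simpa using init_prepend hi
    · obtain ⟨h1, h2⟩ := Prod.mk.inj hij
      refine Prod.ext (β.path.injective (Subtype.ext ?_)) h2
      rw [← shift_prepend hi, ← shift_prepend hj, β.path.symm.injective h1]
    · let x : w.orbit := ⟨shift (Λ.d a) (β.path i.1).1, shift_mem_orbit _ (β.path i.1).2⟩
      refine ⟨(β.path.symm x, i.2), ?_, Prod.ext ?_ rfl⟩
      · simpa [x] using source_eq_range_shift hi
      · simpa [Equiv.symm_apply_eq] using eq_prepend (x := x) hi rfl
  iUnion_K n := by
    refine Set.eq_univ_of_forall fun i => ?_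
    simp only [Set.mem_iUnion]
    exact ⟨(β.path i.1).1.init n, d_init _ n, by simp [d_init]⟩
  K_subset_J a b h i hi := by
    change Λ.s a = _
    rw [h, ← r_init _ (Λ.d b)]
    exact congrArg Λ.r (Eq.symm hi)
  J_comp a b h := by rw [Λ.s_comp a b h]
  σ_comp a b h i hi := by simp [prepend_comp h hi]
  t_apply a i hi := β.t_apply a _ _ _ (by simpa using init_prepend hi)
    (by simpa using (shift_prepend hi).symm)
  t_apply_zero a i hi := β.t_apply_zero a _ _ hi
  star_apply a i hi := β.star_t_apply a _ _ _ (by simpa using init_prepend hi)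
    (by simpa using (shift_prepend hi).symm)
  star_apply_zero a b hab hd j hj := β.star_t_apply_zero a _ _ fun h => hab <| by
    rw [← h, hd]; exact hj

theorem coversDomain {n : Fin k → ℕ}
    (h : ∀ x ∈ w.orbit, ∃ a, Λ.d a = n ∧ Λ.s a = x.range) :
    β.permutativeSystem.CoversDomain n := by
  refine Set.eq_univ_of_forall fun i => ?_
  obtain ⟨a, h1, h2⟩ := h _ (β.path i.1).2
  simp only [Set.mem_iUnion]
  exact ⟨a, h1, h2⟩

theorem isEncodingMap : β.permutativeSystem.IsEncodingMap fun i => (β.path i.1).1 := by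
  rintro i n a rfl
  rfl

theorem injective_path_fst [Subsingleton B] :
    Function.Injective fun i : X × B => (β.path i.1).1 := fun _ _ h =>
  Prod.ext (β.path.injective (Subtype.ext h)) (Subsingleton.elim _ _)

end OrbitBasis

/-- Orthonormality holds within a fiber because transport is isometric and across fibers by their
orthogonality; totality holds because transport is onto each orbit fiber. -/
theorem exists_orbitBasis {w : InfinitePath Λ} (hw : w.Aperiodic) (hT : T.IsPurelyAtomic)
    (hs : T.IsSupportedOn w.orbit) :
    ∃ (X B : Type v), Nonempty (T.OrbitBasis w X B) := by
  have : Countable w.orbit := w.countable_orbit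
  have : CompleteSpace (T.fiber w) := (isClosed_fiber w).completeSpace_coe
  obtain ⟨P, hP, -⟩ := id hT
  obtain ⟨B, f, hf⟩ := exists_hilbertBasis ℂ (T.fiber w)
  -- The index set must live in the universe of `H`; the orbit, being countable, has a copy there.
  let φ : Shrink.{v} w.orbit ≃ w.orbit := (equivShrink _).symm
  let g : Shrink.{v} w.orbit × B → H := fun i => T.transport (φ i.1) (f i.2)
  have hg : Orthonormal ℂ g := by
    classical
    rw [orthonormal_iff_ite]
    rintro ⟨x, b⟩ ⟨y, c⟩
    by_cases hxy : x = y
    · subst hxy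
      have := orthonormal_iff_ite.1 f.orthonormal b c
      simp only [g]
      rw [inner_transport_transport _ (f c).2, ← Submodule.coe_inner, this]
      simp
    · rw [if_neg (by simp [hxy])]
      exact hP.inner_eq_zero_of_mem_fiber (fun h => hxy (φ.injective (Subtype.ext h)))
        (transport_mem_fiber _ (f b).2) (transport_mem_fiber _ (f c).2)
  have htot : (Submodule.span ℂ (Set.range g))ᗮ = ⊥ := by
    refine (Submodule.eq_bot_iff _).2 fun η hη => ?_
    rw [Submodule.mem_orthogonal'] at hη
    refine eq_zero_of_forall_inner_fiber hT hs fun x hx ξ hξ => ?_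
    -- The functional `⟪η, transport ·⟫` vanishes on a basis of the fiber of `w`, hence on that
    -- whole fiber.
    have h1 : innerSL ℂ η ∘L T.transport ⟨x, hx⟩ ∘L (T.fiber w).subtypeL = 0 := by
      refine ContinuousLinearMap.ext_on
        (Submodule.dense_iff_topologicalClosure_eq_top.2 f.dense_span) ?_
      rintro _ ⟨b, rfl⟩
      have := hη _ (Submodule.subset_span ⟨(φ.symm ⟨x, hx⟩, b), rfl⟩)
      simpa [g] using this
    have h2 := DFunLike.congr_fun h1 ⟨_, adjoint_transport_mem_fiber ⟨x, hx⟩ hξ⟩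
    simpa [transport_adjoint_transport ⟨x, hx⟩ hξ] using h2
  refine ⟨Shrink.{v} w.orbit, B, ⟨⟨φ, HilbertBasis.mkOfOrthogonalEqBot hg htot, ?_, ?_, ?_, ?_⟩⟩⟩
  all_goals simp only [HilbertBasis.coe_mkOfOrthogonalEqBot, g]
  · exact fun a x y b h h' => t_apply_transport hw h h' (f b).2
  · exact fun a x y b h h' => star_t_apply_transport hw h h' (f b).2
  · exact fun a x b h => t_apply_eq_zero_of_mem_fiber (transport_mem_fiber _ (f b).2) h
  · exact fun a x b h =>
      hP.star_t_apply_eq_zero_of_mem_fiber (transport_mem_fiber _ (f b).2) h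

end CKFamily

/-! ### Reducing subspaces and the splitting by multiplicity label. -/

namespace CKFamily

open InfinitePath

variable {k : ℕ} {Λ : KGraph.{u} k} {H : Type v} [NormedAddCommGroup H]
  [InnerProductSpace ℂ H] [CompleteSpace H] {T : CKFamily Λ H}

theorem adjoint_restrict_eq {V : Submodule ℂ H} [CompleteSpace V] {A : H →L[ℂ] H}
    (h : ∀ x ∈ V, A x ∈ V) (h' : ∀ x ∈ V, star A x ∈ V) :
    star (A.restrict h) = (star A).restrict h' := by
  rw [ContinuousLinearMap.star_eq_adjoint, eq_comm, ContinuousLinearMap.eq_adjoint_iff]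
  intro x y
  simp only [Submodule.coe_inner, ContinuousLinearMap.coe_restrict_apply]
  rw [ContinuousLinearMap.star_eq_adjoint, ContinuousLinearMap.adjoint_inner_left]

variable (T) in
/-- The restriction of a representation to a closed reducing subspace. -/
noncomputable def restrict (hrf : Λ.RowFinite) (V : Submodule ℂ H) [CompleteSpace V]
    (h : ∀ a, ∀ x ∈ V, T.t a x ∈ V) (h' : ∀ a, ∀ x ∈ V, star (T.t a) x ∈ V) :
    CKFamily Λ V where
  t a := (T.t a).restrict (h a)
  partial_isometry a := by
    rw [adjoint_restrict_eq (h a) (h' a)]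
    ext x
    exact T.t_star_t_apply_t_apply a x
  proj x := by
    refine ⟨?_, ?_⟩
    · ext y
      exact congrArg (fun A : H →L[ℂ] H => A y) (T.proj x).isIdempotentElem
    · rw [IsSelfAdjoint, adjoint_restrict_eq (h _) (h' _)]
      ext y
      exact congrArg (fun A : H →L[ℂ] H => A y) (T.star_t_one x)
  orthogonal x y hxy := by
    ext z
    exact congrArg (fun A : H →L[ℂ] H => A z) (T.orthogonal x y hxy)
  mul a b hab := by
    ext z
    exact T.t_mul_t_apply hab z
  star_mul a := by
    rw [adjoint_restrict_eq (h a) (h' a)]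
    ext x
    exact T.star_t_apply_t_apply a x
  sum x n := by
    have hT := T.sum x n
    -- Row-finiteness turns both `finsum`s into honest sums over one finite set, which restrict
    -- termwise.
    rw [finsum_mem_eq_finite_toFinset_sum _ (hrf x n)] at hT ⊢
    ext y
    have := congrArg (fun A : H →L[ℂ] H => A y) hT
    simp only [sum_apply, Submodule.coe_sum,
      adjoint_restrict_eq (h _) (h' _)] at this ⊢
    exact this

namespace OrbitBasis

variable {w : InfinitePath Λ} {X B : Type v} (β : T.OrbitBasis w X B)

/-- The closed span of the basis vectors of multiplicity label `b`, as an orthogonal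
complement. -/
noncomputable def summand (b : B) : Submodule ℂ H :=
  (Submodule.span ℂ {v | ∃ x c, c ≠ b ∧ v = β.e (x, c)})ᗮ

instance (b : B) : CompleteSpace (β.summand b) :=
  inferInstanceAs (CompleteSpace ((Submodule.span ℂ _)ᗮ : Submodule ℂ H))

theorem mem_summand {b : B} {v : H} :
    v ∈ β.summand b ↔ ∀ x c, c ≠ b → ⟪β.e (x, c), v⟫_ℂ = 0 := by
  rw [summand, ← Submodule.mem_toAddSubgroup]
  refine (Submodule.mem_orthogonal _ _).trans ⟨fun h x c hc => ?_, fun h u hu => ?_⟩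
  · exact h _ (Submodule.subset_span ⟨x, c, hc, rfl⟩)
  · induction hu using Submodule.span_induction with
    | mem u hu => obtain ⟨x, c, hc, rfl⟩ := hu; exact h x c hc
    | zero => exact inner_zero_left _
    | add u v _ _ hu hv => rw [inner_add_left, hu, hv, add_zero]
    | smul r u _ hu => rw [inner_smul_left, hu, mul_zero]

theorem e_mem_summand (x : X) (b : B) : β.e (x, b) ∈ β.summand b :=
  β.mem_summand.2 fun _ _ hc => β.e.orthonormal.2 fun h => hc (Prod.mk.inj h).2

/-- The label `b` never changes, here and in `t_e_eq`; this makes each summand reducing. -/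
theorem star_t_e_eq (a : Λ.Mor) (x : X) (b : B) :
    star (T.t a) (β.e (x, b)) = 0 ∨ ∃ y, star (T.t a) (β.e (x, b)) = β.e (y, b) := by
  by_cases h : (β.path x).1.init (Λ.d a) = a
  · refine .inr ⟨β.path.symm ⟨_, shift_mem_orbit (Λ.d a) (β.path x).2⟩,
      β.star_t_apply a _ _ _ h ?_⟩
    simp
  · exact .inl (β.star_t_apply_zero _ _ _ h)

theorem t_e_eq (a : Λ.Mor) (x : X) (b : B) :
    T.t a (β.e (x, b)) = 0 ∨ ∃ y, T.t a (β.e (x, b)) = β.e (y, b) := by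
  by_cases h : Λ.s a = (β.path x).1.range
  · refine .inr ⟨β.path.symm (prepend a (β.path x)), β.t_apply a _ _ _ ?_ ?_⟩
    · simpa using init_prepend h
    · simpa using (shift_prepend h).symm
  · exact .inl (β.t_apply_zero _ _ _ h)

theorem t_mem_summand (a : Λ.Mor) {b : B} : ∀ v ∈ β.summand b, T.t a v ∈ β.summand b := by
  refine fun v hv => β.mem_summand.2 fun x c hc => ?_
  rw [← ContinuousLinearMap.adjoint_inner_left, ← ContinuousLinearMap.star_eq_adjoint]
  obtain h | ⟨y, h⟩ := β.star_t_e_eq a x c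
  · rw [h, inner_zero_left]
  · rw [h, β.mem_summand.1 hv y c hc]

theorem star_t_mem_summand (a : Λ.Mor) {b : B} :
    ∀ v ∈ β.summand b, star (T.t a) v ∈ β.summand b := by
  refine fun v hv => β.mem_summand.2 fun x c hc => ?_
  rw [ContinuousLinearMap.star_eq_adjoint, ContinuousLinearMap.adjoint_inner_right]
  obtain h | ⟨y, h⟩ := β.t_e_eq a x c
  · rw [h, inner_zero_left]
  · rw [h, β.mem_summand.1 hv y c hc]

/-- In the Parseval expansion of the inner product, each basis vector is orthogonal to one of the
two vectors. -/
theorem orthogonalFamily_summand :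
    OrthogonalFamily ℂ (fun b => β.summand b) fun b => (β.summand b).subtypeₗᵢ := by
  intro b c hbc v u
  refine (β.e.hasSum_inner_mul_inner (v : H) u).unique ?_
  convert hasSum_zero using 2 with i
  by_cases h : i.2 = b
  · rw [β.mem_summand.1 u.2 i.1 i.2 (h ▸ hbc), mul_zero]
  · rw [inner_eq_zero_symm.1 (β.mem_summand.1 v.2 i.1 i.2 h), zero_mul]

/-- The restriction of the representation to a summand. -/
noncomputable def summandRep (hrf : Λ.RowFinite) (b : B) : CKFamily Λ (β.summand b) :=
  T.restrict hrf (β.summand b) (fun a => β.t_mem_summand a) fun a => β.star_t_mem_summand a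

theorem coe_star_summandRep (hrf : Λ.RowFinite) (b : B) (a : Λ.Mor) (x : β.summand b) :
    (star ((β.summandRep hrf b).t a) x : H) = star (T.t a) x := by
  change ((star ((T.t a).restrict (β.t_mem_summand a)) x : β.summand b) : H) = _
  rw [adjoint_restrict_eq (β.t_mem_summand a) (β.star_t_mem_summand a)]
  rfl

/-- The decomposition along the multiplicity set. -/
noncomputable def directSumDecomposition (hrf : Λ.RowFinite) : T.DirectSumDecomposition where
  ι := B
  V := β.summand
  complete _ := inferInstance
  isHilbertSum := by
    refine .mkInternal (F := β.summand) β.orthogonalFamily_summand ?_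
    rw [← β.e.dense_span]
    refine Submodule.topologicalClosure_mono (Submodule.span_le.2 ?_)
    rintro _ ⟨i, rfl⟩
    exact Submodule.mem_iSup_of_mem i.2 (β.e_mem_summand i.1 i.2)
  rep := β.summandRep hrf
  coe_rep _ _ _ := rfl
  coe_star_rep := β.coe_star_summandRep hrf

/-- The one-point factor lets the summand be an `OrbitBasis` again, now with multiplicity one. -/
theorem orthonormal_summand (b : B) : Orthonormal ℂ fun i : X × PUnit.{v + 1} =>
    (⟨β.e (i.1, b), β.e_mem_summand i.1 b⟩ : β.summand b) := by
  refine ⟨fun i => β.e.orthonormal.1 _, fun i j hij => β.e.orthonormal.2 fun h => hij ?_⟩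
  exact Prod.ext (Prod.mk.inj h).1 rfl

/-- The basis of a summand, with multiplicity one. -/
noncomputable def summandHilbertBasis (b : B) : HilbertBasis (X × PUnit.{v + 1}) ℂ (β.summand b) :=
  .mkOfOrthogonalEqBot (β.orthonormal_summand b)
    (by
      refine (Submodule.eq_bot_iff _).2 fun v hv => Subtype.ext ?_
      have h0 : ∀ i, ⟪β.e i, (v : H)⟫_ℂ = 0 := fun i => by
        by_cases h : i.2 = b
        · obtain ⟨x, c⟩ := i
          subst h
          exact (Submodule.mem_orthogonal _ _).1 hv _ (Submodule.subset_span ⟨(x, ⟨⟩), rfl⟩)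
        · exact β.mem_summand.1 v.2 _ _ h
      refine inner_self_eq_zero.1 ((β.e.hasSum_inner_mul_inner (v : H) v).unique ?_)
      simp [h0])

theorem summandHilbertBasis_apply (b : B) (i) :
    β.summandHilbertBasis b i = ⟨β.e (i.1, b), β.e_mem_summand i.1 b⟩ := by
  rw [summandHilbertBasis, HilbertBasis.coe_mkOfOrthogonalEqBot]

/-- The orbit basis of a summand, with multiplicity one. -/
noncomputable def summandOrbitBasis (hrf : Λ.RowFinite) (b : B) :
    (β.summandRep hrf b).OrbitBasis w X PUnit.{v + 1} where
  path := β.path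
  e := β.summandHilbertBasis b
  t_apply a x y c h h' := Subtype.ext <| by
    simp only [summandHilbertBasis_apply]
    exact β.t_apply a x y b h h'
  star_t_apply a x y c h h' := Subtype.ext <| by
    simp only [summandHilbertBasis_apply, coe_star_summandRep]
    exact β.star_t_apply a x y b h h'
  t_apply_zero a x c h := Subtype.ext <| by
    simp only [summandHilbertBasis_apply]
    exact β.t_apply_zero a x b h
  star_t_apply_zero a x c h := Subtype.ext <| by
    simp only [summandHilbertBasis_apply, coe_star_summandRep]
    exact β.star_t_apply_zero a x b h

end OrbitBasis

end CKFamily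

theorem mainTheorem11 {k : ℕ} (Λ : KGraph.{u} k) (hrf : Λ.RowFinite) (hns : Λ.NoSources)
    {H : Type v} [NormedAddCommGroup H] [InnerProductSpace ℂ H] [CompleteSpace H]
    (T : CKFamily Λ H) (hT : T.IsPurelyAtomic)
    (w : InfinitePath Λ) (hw : w.Aperiodic) (hsupp : T.IsSupportedOn w.orbit) :
    (∃ S : T.PermutativeSystem,
      ∀ n : Fin k → ℕ, (∀ x ∈ w.orbit, ∃ a, Λ.d a = n ∧ Λ.s a = x.range) → S.CoversDomain n) ∧
    ∃ D : T.DirectSumDecomposition, ∀ l : D.ι,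
      ∃ S : (D.rep l).PermutativeSystem,
        (∀ n : Fin k → ℕ, (∀ x ∈ w.orbit, ∃ a, Λ.d a = n ∧ Λ.s a = x.range) →
          S.CoversDomain n) ∧
        ∃ E : S.I → InfinitePath Λ, S.IsEncodingMap E ∧ Function.Injective E := by
  obtain ⟨X, B, ⟨β⟩⟩ := CKFamily.exists_orbitBasis hw hT hsupp
  refine ⟨⟨β.permutativeSystem, fun n => β.coversDomain⟩, β.directSumDecomposition hrf,
    fun (b : B) => ?_⟩
  let γ := CKFamily.OrbitBasis.summandOrbitBasis β hrf b
  exact ⟨γ.permutativeSystem, fun n => γ.coversDomain, _, γ.isEncodingMap,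
    γ.injective_path_fst⟩
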